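/- Let $\Lambda$ be a non-empty set (finite, countable or uncountable), and let $\mathbb{F}^+_\Lambda$ be the free semigroup with unit (the empty word) on generators $\{z_\alpha\}_{\alpha\in\Lambda}$. Let $\{\xi_w : w\in\mathbb{F}^+_\Lambda\}$ be the canonical orthonormal basis of $\mathcal{H}_\Lambda=\ell^2(\mathbb{F}^+_\Lambda)$, and for $\alpha\in\Lambda$ let $L_\alpha\in B(\mathcal{H}_\Lambda)$ be the isometry determined by $L_\alpha\xi_w=\xi_{z_\alpha w}$ for all $w\in\mathbb{F}^+_\Lambda$. Let $\mathfrak{L}_\Lambda\subseteq B(\mathcal{H}_\Lambda)$ be the weak-operator closed unital algebra generated by $\{L_\alpha\}_{\alpha\in\Lambda}$, and let $\mathfrak{A}_\Lambda$ be the norm closed unital algebra generated by $\{L_\alpha\}_{\alpha\in\Lambda}$; both carry the operator norm. For $\mathcal{B}\in\{\mathfrak{L}_\Lambda,\mathfrak{A}_\Lambda\}$, a derivation of $\mathcal{B}$ is a $\mathbb{C}$-linear map $D\colon\mathcal{B}\to\mathcal{B}$ with $D(ST)=S\,D(T)+D(S)\,T$ for all $S,T\in\mathcal{B}$; no continuity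 is assumed. Theorem. Every derivation $D$ of $\mathfrak{L}_\Lambda$ and every derivation $D$ of $\mathfrak{A}_\Lambda$ is norm-continuous; that is, $\|D\|=\sup\{\|D(T)\| : T\in\mathcal{B},\ \|T\|=1\}<\infty$, where $\mathcal{B}$ is the algebra in question. -/

import Mathlib

namespace FreeSemigroupAlgebra

/-- The Hilbert space `ℓ²(𝔽⁺_Λ)` of square summable complex functions on the free semigroup with
unit (the empty word) generated by `Λ`. -/
abbrev Fock (Λ : Type*) : Type _ := lp (fun _ : FreeMonoid Λ => ℂ) 2

open Classical in
/-- The basis vector `ξ_w`: the indicator function of the word `w`. -/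
noncomputable def xi {Λ : Type*} (w : FreeMonoid Λ) : Fock Λ := lp.single 2 w (1 : ℂ)

theorem orthonormal_xi (Λ : Type*) : Orthonormal ℂ (xi : FreeMonoid Λ → Fock Λ) := by
  classical
  rw [orthonormal_iff_ite]
  intro i j
  unfold xi
  rw [lp.inner_single_left, lp.single_apply]
  by_cases h : i = j
  · subst h; simp
  · simp [h]

theorem orthonormal_xi_mul {Λ : Type*} (u : FreeMonoid Λ) :
    Orthonormal ℂ (fun w : FreeMonoid Λ => (xi (u * w) : Fock Λ)) :=
  (orthonormal_xi Λ).comp (fun w => u * w) (mul_right_injective u)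

/-- The generator `L_α` of the left regular representation: the isometry
`f ↦ ∑ w, f w • ξ_{z_α w}`, i.e. the bounded operator with `L_α ξ_w = ξ_{z_α w}`
for every word `w`. -/
noncomputable def L {Λ : Type*} (α : Λ) : Fock Λ →L[ℂ] Fock Λ :=
  (orthonormal_xi_mul (FreeMonoid.of α)).orthogonalFamily.linearIsometry.toContinuousLinearMap

theorem L_xi {Λ : Type*} (α : Λ) (w : FreeMonoid Λ) :
    L α (xi w) = xi (FreeMonoid.of α * w) := by
  classical
  have h := (orthonormal_xi_mul (FreeMonoid.of α)).orthogonalFamily.linearIsometry_apply_single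
    (i := w) (1 : ℂ)
  rw [LinearIsometry.toSpanSingleton_apply, one_smul] at h
  rw [← h]
  unfold L xi
  simp only [LinearIsometry.coe_toContinuousLinearMap]

/-- The unital subalgebra of `B(ℓ²(𝔽⁺_Λ))` generated algebraically by the `L_α`. -/
noncomputable def polyAlg (Λ : Type*) : Subalgebra ℂ (Fock Λ →L[ℂ] Fock Λ) :=
  Algebra.adjoin ℂ (Set.range (L : Λ → Fock Λ →L[ℂ] Fock Λ))

/-- The non-commutative disc algebra `𝔄_Λ`: the (unital) norm closed algebra generated
by the `L_α`. -/
noncomputable def discAlg (Λ : Type*) : Subalgebra ℂ (Fock Λ →L[ℂ] Fock Λ) :=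
  (polyAlg Λ).topologicalClosure

/-- The left regular free semigroup algebra `𝔏_Λ`: the (unital) weak-operator closed algebra
generated by the `L_α`. The closure is taken in `B(ℓ²(𝔽⁺_Λ))` with the weak operator topology;
the result is regarded as an algebra of bounded operators, with the operator norm. -/
noncomputable def leftRegularAlg (Λ : Type*) : Subalgebra ℂ (Fock Λ →L[ℂ] Fock Λ) :=
  ((polyAlg Λ).comap
    (ContinuousLinearMapWOT.algEquiv (𝕜₁ := ℂ) (E := Fock Λ) ℂ).toAlgHom).topologicalClosure.map
      (ContinuousLinearMapWOT.algEquiv (𝕜₁ := ℂ) (E := Fock Λ) ℂ).toAlgHom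

theorem mem_leftRegularAlg_iff {Λ : Type*} (T : Fock Λ →L[ℂ] Fock Λ) :
    T ∈ leftRegularAlg Λ ↔ ContinuousLinearMapWOT.ofCLM T ∈
      closure {S : Fock Λ →WOT[ℂ] Fock Λ | S.toCLM ∈ polyAlg Λ} := by
  constructor
  · rintro ⟨S, hS, rfl⟩
    exact hS
  · intro h
    exact ⟨ContinuousLinearMapWOT.ofCLM T, h, rfl⟩

/-- A linear map of an algebra into itself is a derivation if it satisfies the Leibniz rule. -/
def IsDerivation {B : Type*} [Ring B] [Algebra ℂ B] (D : B →ₗ[ℂ] B) : Prop :=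
  ∀ S T : B, D (S * T) = S * D T + D S * T

/-- `‖D‖ = sup {‖D T‖ : ‖T‖ = 1}` is finite. -/
def HasFiniteNorm {B : Type*} [NormedRing B] [NormedAlgebra ℂ B] (D : B →ₗ[ℂ] B) : Prop :=
  BddAbove {r : ℝ | ∃ T : B, ‖T‖ = 1 ∧ r = ‖D T‖}

end FreeSemigroupAlgebra

namespace FreeSemigroupAlgebra

/-! ### Derivations of algebras containing an isometry -/

section CStar

variable {A : Type*} [NormedRing A] [StarRing A]

/-! A single isometry `V = L α` in the algebra suffices. A gliding hump shows that `x ↦ (1 - V V*) D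
x` is bounded: otherwise small `x_k` with huge images are packed into one element `T = ∑ V^k x_k`,
and compressing `D T` by `1 - V^(n+1) V*^(n+1)` isolates the `n`-th hump, so `‖D T‖ > n` for every
`n`. Applied to all powers of `V`, this places the separating space of `D` in `⋂ V^n A`, which is
zero as `L α` is pure; the closed graph theorem concludes. -/

theorem star_pow_mul_pow {W : A} (hW : star W * W = 1) (n : ℕ) : star (W ^ n) * W ^ n = 1 := by
  rw [star_pow, pow_mul_pow_eq_one n hW]

theorem isStarProjection_one_sub_mul_star {W : A} (hW : star W * W = 1) :
    IsStarProjection (1 - W * star W) := by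
  refine IsStarProjection.one_sub ⟨?_, ?_⟩
  · rw [IsIdempotentElem, mul_assoc, ← mul_assoc (star W), hW, one_mul]
  · simp [IsSelfAdjoint]

theorem one_sub_mul_star_mul_self {W : A} (hW : star W * W = 1) (y : A) :
    (1 - W * star W) * (W * y) = 0 := by
  rw [← mul_assoc, sub_mul, one_mul, mul_assoc W, hW, mul_one, sub_self, zero_mul]

theorem one_sub_pow_succ_mul_pow {W : A} (hW : star W * W = 1) (n : ℕ) (y : A) :
    (1 - W ^ (n + 1) * star (W ^ (n + 1))) * (W ^ n * y) =
      W ^ n * ((1 - W * star W) * y) := by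
  have h : star (W ^ (n + 1)) * W ^ n = star W := by
    rw [pow_succ, star_mul, mul_assoc, star_pow_mul_pow hW, mul_one]
  rw [← mul_assoc, ← mul_assoc, sub_mul, mul_sub, one_mul, mul_one, mul_assoc, h, pow_succ,
    mul_assoc]

variable [CStarRing A]

theorem norm_isometry_mul {W : A} (hW : star W * W = 1) (y : A) : ‖W * y‖ = ‖y‖ := by
  have h : ‖W * y‖ * ‖W * y‖ = ‖y‖ * ‖y‖ := by
    rw [← CStarRing.norm_star_mul_self, ← CStarRing.norm_star_mul_self, star_mul, mul_assoc,
      ← mul_assoc (star W), hW, one_mul]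
  exact (mul_self_inj (norm_nonneg _) (norm_nonneg _)).mp h

theorem norm_one_sub_mul_star_mul_le {W : A} (hW : star W * W = 1) (y : A) :
    ‖(1 - W * star W) * y‖ ≤ ‖y‖ :=
  (norm_mul_le _ _).trans <| mul_le_of_le_one_left (norm_nonneg _)
    (IsStarProjection.norm_le _ (isStarProjection_one_sub_mul_star hW))

variable [NormedAlgebra ℂ A]

/-- Modulo the right ideal generated by an isometry `V`, a derivation is automatically bounded. -/
theorem IsDerivation.exists_bound_one_sub_mul_star {B : Subalgebra ℂ A} [CompleteSpace B]
    {D : B →ₗ[ℂ] B} (hD : IsDerivation D) (V : B) (hV : star (V : A) * V = 1) :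
    ∃ C : ℝ, ∀ x : B, ‖(1 - V * star (V : A)) * (D x : A)‖ ≤ C * ‖x‖ := by
  by_contra! hunb
  -- The summands beyond `n` will absorb the Leibniz cross terms and the earlier partial sum `s`;
  -- the factor 2 bounds the norm of the remaining tail.
  have step (n : ℕ) (s : B) : ∃ x : B, ‖x‖ ≤ (1 / 2) ^ n ∧
      n + ‖D (V ^ n)‖ * ‖x‖ + ‖D s‖ + 2 * ‖D (V ^ (n + 1))‖ <
        ‖(1 - V * star (V : A)) * (D x : A)‖ := by
    set K : ℝ := n + ‖D s‖ + 2 * ‖D (V ^ (n + 1))‖ with hK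
    have hK0 : 0 ≤ K := by positivity
    obtain ⟨x, hx⟩ := hunb (‖D (V ^ n)‖ + K * 2 ^ n)
    have hx0 : 0 < ‖x‖ := by
      rw [norm_pos_iff]
      rintro rfl
      simp at hx
    set c : ℝ := (1 / 2) ^ n / ‖x‖ with hc
    have hc0 : 0 < c := by positivity
    have hcn : ‖(c : ℂ)‖ = c := by simp [abs_of_pos hc0]
    have hcx : c * ‖x‖ = (1 / 2) ^ n := by rw [hc]; field_simp
    refine ⟨(c : ℂ) • x, ?_, ?_⟩
    · rw [norm_smul, hcn, hcx]
    · have h1 : ‖(1 - V * star (V : A)) * (D ((c : ℂ) • x) : A)‖ =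
          c * ‖(1 - V * star (V : A)) * (D x : A)‖ := by
        rw [map_smul, Subalgebra.coe_smul, mul_smul_comm, norm_smul, hcn]
      have h2 : (1 / 2 : ℝ) ^ n * 2 ^ n = 1 := by rw [← mul_pow]; norm_num
      have h3 := mul_lt_mul_of_pos_left hx hc0
      rw [h1, norm_smul, hcn]
      calc n + ‖D (V ^ n)‖ * (c * ‖x‖) + ‖D s‖ + 2 * ‖D (V ^ (n + 1))‖
          = ‖D (V ^ n)‖ * (c * ‖x‖) + K * ((1 / 2 : ℝ) ^ n * 2 ^ n) := by rw [h2, hK]; ring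
        _ = c * ((‖D (V ^ n)‖ + K * 2 ^ n) * ‖x‖) := by rw [← hcx]; ring
        _ < _ := h3
  choose f hf using step
  -- The choice is recursive because `D (s n)` has no a priori bound.
  let s : ℕ → B := fun n => Nat.rec 0 (fun n t => t + V ^ n * f n t) n
  let x : ℕ → B := fun n => f n (s n)
  have hs (n : ℕ) : s (n + 1) = s n + V ^ n * x n := rfl
  have hsum (n : ℕ) : s n = ∑ k ∈ Finset.range n, V ^ k * x k := by
    induction n with
    | zero => rfl
    | succ n ih => rw [Finset.sum_range_succ, ← ih, hs]
  have hVn (n : ℕ) : star ((V ^ n : B) : A) * ((V ^ n : B) : A) = 1 := star_pow_mul_pow hV n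
  have hnorm (n : ℕ) (y : B) : ‖V ^ n * y‖ = ‖y‖ := norm_isometry_mul (hVn n) (y : A)
  have hx (n : ℕ) : ‖x n‖ ≤ (1 / 2) ^ n := (hf n (s n)).1
  have hsummable : Summable fun k => V ^ k * x k :=
    .of_norm_bounded summable_geometric_two fun k => by rw [hnorm]; exact hx k
  have htail (n k : ℕ) : ‖V ^ k * x (k + n)‖ ≤ (1 / 2) ^ k := by
    rw [hnorm]
    exact (hx _).trans (pow_le_pow_of_le_one (by norm_num) (by norm_num) (by omega))
  obtain ⟨n, hn⟩ := exists_nat_gt ‖D (∑' k, V ^ k * x k)‖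
  set r : B := ∑' k, V ^ k * x (k + (n + 1)) with hr
  have hr2 : ‖r‖ ≤ 2 := tsum_of_norm_bounded hasSum_geometric_two (htail (n + 1))
  have hrs : Summable fun k => V ^ k * x (k + (n + 1)) :=
    .of_norm_bounded summable_geometric_two (htail (n + 1))
  have hdecomp : ∑' k, V ^ k * x k = s n + V ^ n * x n + V ^ (n + 1) * r := by
    rw [← hs, hsum (n + 1), ← hsummable.sum_add_tsum_nat_add (n + 1), hr, ← hrs.tsum_mul_left]
    congr 2 with k
    rw [pow_add V k, ← mul_assoc, ← pow_add, ← pow_add, add_comm k]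
  set Q : A := 1 - (V : A) ^ (n + 1) * star ((V : A) ^ (n + 1)) with hQ
  have hQle (y : A) : ‖Q * y‖ ≤ ‖y‖ := norm_one_sub_mul_star_mul_le (hVn (n + 1)) y
  have hmul (y z : B) : ‖(y : A) * (z : A)‖ ≤ ‖y‖ * ‖z‖ := norm_mul_le _ _
  -- Leibniz on the decomposition; `Q` kills `V^(n+1) D r`, the only uncontrolled term.
  have hkey : (V : A) ^ n * ((1 - V * star (V : A)) * (D (x n) : A)) =
      Q * (D (∑' k, V ^ k * x k) : A) - Q * (D (s n) : A) -
        Q * ((D (V ^ n) : A) * x n) - Q * ((D (V ^ (n + 1)) : A) * r) := by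
    have h1 := one_sub_pow_succ_mul_pow hV n (D (x n) : A)
    have h2 := one_sub_mul_star_mul_self (hVn (n + 1)) (D r : A)
    rw [SubmonoidClass.coe_pow, ← hQ] at h2
    rw [← hQ] at h1
    rw [hdecomp, map_add, map_add, hD, hD, ← h1]
    push_cast
    simp only [mul_add]
    rw [h2]
    abel
  have hlt := (hf n (s n)).2
  have heq : ‖(1 - V * star (V : A)) * (D (x n) : A)‖ =
      ‖(V : A) ^ n * ((1 - V * star (V : A)) * (D (x n) : A))‖ :=
    (norm_isometry_mul (hVn n) _).symm
  have hle : ‖(1 - V * star (V : A)) * (D (x n) : A)‖ ≤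
      ‖D (∑' k, V ^ k * x k)‖ + ‖D (s n)‖ + ‖D (V ^ n)‖ * ‖x n‖ +
        ‖D (V ^ (n + 1))‖ * ‖r‖ := by
    rw [heq, hkey]
    refine (norm_sub_le _ _).trans (add_le_add ((norm_sub_le _ _).trans
      (add_le_add ((norm_sub_le _ _).trans (add_le_add (hQle _) (hQle _))) ?_)) ?_)
    · exact (hQle _).trans (hmul _ _)
    · exact (hQle _).trans (hmul _ _)
  have := mul_le_mul_of_nonneg_left hr2 (norm_nonneg (D (V ^ (n + 1))))
  change _ < ‖(1 - V * star (V : A)) * (D (x n) : A)‖ at hlt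
  change n + ‖D (V ^ n)‖ * ‖x n‖ + _ + _ < _ at hlt
  linarith

/-- A complete algebra of operators containing a pure isometry has only continuous derivations. -/
theorem IsDerivation.continuous_of_pure_isometry {B : Subalgebra ℂ A} [CompleteSpace B]
    {D : B →ₗ[ℂ] B} (hD : IsDerivation D) (V : B) (hV : star (V : A) * V = 1)
    (hpure : ∀ y : A, (∀ n : ℕ, (V : A) ^ n * star ((V : A) ^ n) * y = y) → y = 0) :
    Continuous D := by
  refine D.continuous_of_seq_closed_graph fun u x y hu hDu => ?_
  suffices h : y - D x = 0 from sub_eq_zero.mp h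
  have h0 : Filter.Tendsto (fun k => u k - x) Filter.atTop (nhds 0) := by
    simpa using hu.sub_const x
  have h1 : Filter.Tendsto (fun k => (D (u k - x) : A)) Filter.atTop (nhds (y - D x : B)) := by
    refine (continuous_subtype_val.tendsto _).comp ?_
    simp only [map_sub]
    exact hDu.sub_const (D x)
  refine Subtype.ext (hpure _ fun n => ?_)
  -- `C` may depend on `n`: only the limit in `k` is taken.
  obtain ⟨C, hC⟩ := hD.exists_bound_one_sub_mul_star (V ^ n) (star_pow_mul_pow hV n)
  have h2 : Filter.Tendsto (fun k => C * ‖u k - x‖) Filter.atTop (nhds 0) := by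
    simpa using h0.norm.const_mul C
  have h3 := squeeze_zero_norm (fun k => hC (u k - x)) h2
  have h4 := tendsto_nhds_unique h3 (h1.const_mul _)
  rw [sub_mul, one_mul] at h4
  exact (sub_eq_zero.mp h4.symm).symm

end CStar

theorem hasFiniteNorm_of_continuous {B : Type*} [NormedRing B] [NormedAlgebra ℂ B]
    {D : B →ₗ[ℂ] B} (hD : Continuous D) : HasFiniteNorm D := by
  refine ⟨‖(⟨D, hD⟩ : B →L[ℂ] B)‖, ?_⟩
  rintro r ⟨T, hT, rfl⟩
  simpa [hT] using (⟨D, hD⟩ : B →L[ℂ] B).le_opNorm T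

/-! ### Purity of the generators and closedness of the algebras -/

variable {Λ : Type*}

theorem star_L_mul_L (α : Λ) : star (L α) * L α = 1 := by
  rw [ContinuousLinearMap.star_eq_adjoint]
  exact ContinuousLinearMap.inner_map_map_iff_adjoint_comp_self (L α) |>.mp
    (LinearIsometry.inner_map_map _)

theorem hasSum_L_apply (α : Λ) (h : Fock Λ) :
    HasSum (fun v : FreeMonoid Λ => h v • (xi (FreeMonoid.of α * v) : Fock Λ)) (L α h) :=
  (orthonormal_xi_mul (FreeMonoid.of α)).orthogonalFamily.hasSum_linearIsometry h

open Classical in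
theorem hasSum_L_coord (α : Λ) (h : Fock Λ) (w : FreeMonoid Λ) :
    HasSum (fun v : FreeMonoid Λ => if FreeMonoid.of α * v = w then h v else 0) (L α h w) := by
  have hs := (hasSum_L_apply α h).mapL (innerSL ℂ (xi w : Fock Λ))
  have hin (f : Fock Λ) : innerSL ℂ (xi w : Fock Λ) f = f w := by
    simp [xi, lp.inner_single_left]
  rw [hin] at hs
  refine (congrArg (HasSum · _) (funext fun v => ?_)).mpr hs
  rw [hin]
  by_cases hv : FreeMonoid.of α * v = w
  · subst hv
    simp [xi]
  · simp [xi, lp.single_apply, hv, Ne.symm hv]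

theorem L_pow_apply_of_length_lt (α : Λ) (h : Fock Λ) (n : ℕ) :
    ∀ w : FreeMonoid Λ, w.length < n → (L α ^ n) h w = 0 := by
  induction n with
  | zero => intro w hw; exact absurd hw (Nat.not_lt_zero _)
  | succ n ih =>
    intro w hw
    classical
    rw [pow_succ', mul_apply_eq_comp]
    refine (hasSum_L_coord α _ w).unique ?_
    convert hasSum_zero with v
    split_ifs with hv
    · subst hv
      rw [FreeMonoid.length_mul, FreeMonoid.length_of] at hw
      exact ih v (by omega)
    · rfl

/-- Vectors in the range of `L α ^ n` vanish on words shorter than `n`, so `n = |w| + 1` kills the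
coordinate at `w`. -/
theorem eq_zero_of_forall_L_pow (α : Λ) (y : Fock Λ →L[ℂ] Fock Λ)
    (hy : ∀ n : ℕ, L α ^ n * star (L α ^ n) * y = y) : y = 0 := by
  ext h w
  rw [← hy (w.length + 1), mul_assoc, mul_apply_eq_comp,
    L_pow_apply_of_length_lt α _ _ w (Nat.lt_succ_self _)]
  rfl

theorem L_mem_polyAlg (α : Λ) : L α ∈ polyAlg Λ :=
  Algebra.subset_adjoin ⟨α, rfl⟩

theorem L_mem_discAlg (α : Λ) : L α ∈ discAlg Λ :=
  (polyAlg Λ).le_topologicalClosure (L_mem_polyAlg α)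

theorem L_mem_leftRegularAlg (α : Λ) : L α ∈ leftRegularAlg Λ :=
  (mem_leftRegularAlg_iff _).mpr (subset_closure (L_mem_polyAlg α))

theorem isClosed_discAlg (Λ : Type*) : IsClosed (discAlg Λ : Set (Fock Λ →L[ℂ] Fock Λ)) :=
  (polyAlg Λ).isClosed_topologicalClosure

/-- The weak operator topology is coarser than the norm topology. -/
theorem isClosed_leftRegularAlg (Λ : Type*) :
    IsClosed (leftRegularAlg Λ : Set (Fock Λ →L[ℂ] Fock Λ)) := by
  have h : (leftRegularAlg Λ : Set (Fock Λ →L[ℂ] Fock Λ)) =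
      ContinuousLinearMapWOT.ofCLM ⁻¹'
        closure {S : Fock Λ →WOT[ℂ] Fock Λ | S.toCLM ∈ polyAlg Λ} :=
    Set.ext mem_leftRegularAlg_iff
  rw [h]
  exact isClosed_closure.preimage ContinuousLinearMapWOT.continuous_ofCLM

theorem IsDerivation.continuous_of_L_mem {B : Subalgebra ℂ (Fock Λ →L[ℂ] Fock Λ)}
    (hB : IsClosed (B : Set (Fock Λ →L[ℂ] Fock Λ))) {α : Λ} (hα : L α ∈ B)
    {D : B →ₗ[ℂ] B} (hD : IsDerivation D) : Continuous D :=
  have : CompleteSpace B := hB.completeSpace_coe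
  hD.continuous_of_pure_isometry ⟨L α, hα⟩ (star_L_mul_L α) (eq_zero_of_forall_L_pow α)

end FreeSemigroupAlgebra

theorem mainTheorem4 (Λ : Type*) [Nonempty Λ] :
    (∀ D : FreeSemigroupAlgebra.leftRegularAlg Λ →ₗ[ℂ] FreeSemigroupAlgebra.leftRegularAlg Λ,
      FreeSemigroupAlgebra.IsDerivation D →
        Continuous D ∧ FreeSemigroupAlgebra.HasFiniteNorm D) ∧
    (∀ D : FreeSemigroupAlgebra.discAlg Λ →ₗ[ℂ] FreeSemigroupAlgebra.discAlg Λ,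
      FreeSemigroupAlgebra.IsDerivation D →
        Continuous D ∧ FreeSemigroupAlgebra.HasFiniteNorm D) := by
  obtain ⟨α⟩ := ‹Nonempty Λ›
  refine ⟨fun D hD => ?_, fun D hD => ?_⟩
  · have h := hD.continuous_of_L_mem (FreeSemigroupAlgebra.isClosed_leftRegularAlg Λ)
      (FreeSemigroupAlgebra.L_mem_leftRegularAlg α)
    exact ⟨h, FreeSemigroupAlgebra.hasFiniteNorm_of_continuous h⟩
  · have h := hD.continuous_of_L_mem (FreeSemigroupAlgebra.isClosed_discAlg Λ)
      (FreeSemigroupAlgebra.L_mem_discAlg α)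
    exact ⟨h, FreeSemigroupAlgebra.hasFiniteNorm_of_continuous h⟩
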